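/- Fix an integer $t \ge 2$. All graphs are finite and simple; $\omega(G)$ is the clique number of $G$, $K_{2,t}$ is the complete bipartite graph with parts of sizes $2$ and $t$, and $\log$ is the natural logarithm. (i) Let $n \ge 1$, let $\alpha \in [0,1]$, and let $G$ be a graph on $n$ vertices with $\alpha\binom{n}{2}$ edges which contains no induced copy of $K_{2,t}$. Then $$\omega(G) \;\ge\; \Bigl\lfloor \tfrac{t-1}{4}\,(\alpha^2 n)^{\frac{1}{t-1}} \Bigr\rfloor - t + 3 .$$ (ii) For every $\alpha_0 > 0$ there is $n_0 = n_0(t,\alpha_0)$ such that for all $n \ge n_0$ and all $\alpha \in [\alpha_0, 1]$, every graph $G$ on $n$ vertices with $\alpha\binom{n}{2}$ edges which contains no induced copy of $K_{2,t}$ satisfies $$\omega(G) \;\ge\; \frac{1}{20t}\,\bigl(\alpha^2 n (\log n)^{t-2}\bigr)^{\frac{1}{t-1}} .$$ -/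

import Mathlib

open scoped Classical in
/-- Every two distinct nonadjacent vertices have at most `K` common neighbours. -/
def SimpleGraph.NonadjCodegreeLE {V : Type*} [Fintype V] (G : SimpleGraph V) (K : ℝ) : Prop :=
  ∀ u v, u ≠ v → ¬ G.Adj u v →
    ((Finset.univ.filter fun w => G.Adj u w ∧ G.Adj v w).card : ℝ) ≤ K

section Counting

open Finset
open scoped Classical

variable {V : Type*} [Fintype V] {G : SimpleGraph V} {K : ℝ}

theorem sum_pairs_le_of_isIndepSet (hK : G.NonadjCodegreeLE K) {S : Finset V}
    (hS : G.IsIndepSet S) :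
    ∑ w, ((#{v ∈ S | G.Adj v w} : ℝ) * ((#{v ∈ S | G.Adj v w} : ℝ) - 1)) ≤
      #S * ((#S : ℝ) - 1) * K := by
  have h1 : ∀ w, ((#{v ∈ S | G.Adj v w} : ℝ) * ((#{v ∈ S | G.Adj v w} : ℝ) - 1)) =
      ∑ p ∈ S.offDiag, if G.Adj p.1 w ∧ G.Adj p.2 w then (1 : ℝ) else 0 := by
    intro w
    have h2 : {p ∈ S.offDiag | G.Adj p.1 w ∧ G.Adj p.2 w} = ({v ∈ S | G.Adj v w}).offDiag := by
      ext p
      simp only [mem_filter, mem_offDiag]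
      tauto
    rw [← Finset.sum_filter, h2, Finset.sum_const, Finset.offDiag_card, nsmul_eq_mul,
      Nat.cast_sub (Nat.le_mul_self _)]
    push_cast
    ring
  simp_rw [h1]
  rw [Finset.sum_comm]
  have h3 : ∀ p ∈ S.offDiag,
      (∑ w, if G.Adj p.1 w ∧ G.Adj p.2 w then (1 : ℝ) else 0) ≤ K := by
    intro p hp
    rw [mem_offDiag] at hp
    have := hK p.1 p.2 hp.2.2 (hS (mem_coe.2 hp.1) (mem_coe.2 hp.2.1) hp.2.2)
    simpa using this
  refine (Finset.sum_le_card_nsmul _ _ _ h3).trans (le_of_eq ?_)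
  rw [Finset.offDiag_card, nsmul_eq_mul, Nat.cast_sub (Nat.le_mul_self _)]
  push_cast
  ring

theorem sum_degree_le_of_isIndepSet (hK : G.NonadjCodegreeLE K) {S : Finset V}
    (hS : G.IsIndepSet S) :
    ∑ v ∈ S, (G.degree v : ℝ) ≤ Fintype.card V - #S + #S * ((#S : ℝ) - 1) / 2 * K := by
  have h1 : ∑ v ∈ S, (G.degree v : ℝ) = ∑ w, (#{v ∈ S | G.Adj v w} : ℝ) := by
    have : ∀ v, (G.degree v : ℝ) = ∑ w, if G.Adj v w then (1 : ℝ) else 0 := by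
      intro v
      rw [← SimpleGraph.card_neighborFinset_eq_degree, SimpleGraph.neighborFinset_eq_filter]
      simp
    simp_rw [this]
    rw [Finset.sum_comm]
    simp
  have h2 : ∀ w, (#{v ∈ S | G.Adj v w} : ℝ) ≤ (if w ∈ Sᶜ then 1 else 0) +
      ((#{v ∈ S | G.Adj v w} : ℝ) * ((#{v ∈ S | G.Adj v w} : ℝ) - 1)) / 2 := by
    intro w
    by_cases hw : w ∈ S
    · have : ({v ∈ S | G.Adj v w} : Finset V) = ∅ := by
        refine filter_eq_empty_iff.2 fun v hv hvw => ?_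
        exact hS (mem_coe.2 hv) (mem_coe.2 hw) hvw.ne hvw
      simp [this, hw]
    · simp only [mem_compl, hw, not_false_eq_true, if_true]
      rcases Nat.lt_or_ge (#{v ∈ S | G.Adj v w}) 2 with h | h
      · interval_cases #{v ∈ S | G.Adj v w} <;> norm_num
      · have : (2 : ℝ) ≤ (#{v ∈ S | G.Adj v w} : ℝ) := by exact_mod_cast h
        nlinarith
  have h3 := sum_pairs_le_of_isIndepSet hK hS
  rw [h1]
  refine (Finset.sum_le_sum fun w _ => h2 w).trans ?_
  rw [Finset.sum_add_distrib, ← Finset.sum_div]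
  have h4 : ∑ w, (if w ∈ Sᶜ then (1 : ℝ) else 0) = Fintype.card V - #S := by
    rw [Finset.sum_ite_mem, univ_inter, sum_const, card_compl, nsmul_eq_mul, mul_one,
      Nat.cast_sub (card_le_univ S)]
  rw [h4]
  linarith

theorem card_le_of_indepSets_lt (hK0 : 0 ≤ K) (hω : ∀ C : Finset V, G.IsClique C → (#C : ℝ) ≤ K)
    (hK : G.NonadjCodegreeLE K) {A : Finset V} {s : ℕ}
    (hA : ∀ I ⊆ A, G.IsIndepSet I → #I < s) :
    (#A : ℝ) ≤ s * ((s : ℝ) - 1) / 2 * K := by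
  obtain ⟨S, hS, hmax⟩ := Finset.exists_max_image
    (Finset.filter (fun I : Finset V => G.IsIndepSet (I : Set V)) A.powerset) Finset.card ⟨∅, by simp [SimpleGraph.IsIndepSet]⟩
  rw [mem_filter, mem_powerset] at hS
  obtain ⟨hSA, hS⟩ := hS
  have hmax' : ∀ I ⊆ A, G.IsIndepSet I → #I ≤ #S := fun I h1 h2 =>
    hmax I (mem_filter.2 ⟨mem_powerset.2 h1, h2⟩)
  let B : V → Finset V := fun v => {w ∈ A | w = v ∨ (G.Adj v w ∧ ∀ u ∈ S, G.Adj u w → u = v)}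
  have hB : ∀ v ∈ S, (#(B v) : ℝ) ≤ K := by
    intro v hv
    apply hω
    intro x hx y hy hxy
    simp only [B, coe_filter, Set.mem_ofPred_eq] at hx hy
    obtain ⟨hxA, hx⟩ := hx
    obtain ⟨hyA, hy⟩ := hy
    rcases hx with rfl | ⟨hvx, hx⟩
    · rcases hy with rfl | ⟨hvy, hy⟩
      · exact absurd rfl hxy
      · exact hvy
    · rcases hy with rfl | ⟨hvy, hy⟩
      · exact hvx.symm
      · by_contra hnadj
        have hxS : x ∉ S := fun h => hS (mem_coe.2 hv) (mem_coe.2 h) hvx.ne hvx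
        have hyS : y ∉ S := fun h => hS (mem_coe.2 hv) (mem_coe.2 h) hvy.ne hvy
        have hx' : ∀ u ∈ S.erase v, ¬ G.Adj u x := fun u hu h =>
          (mem_erase.1 hu).1 (hx u (mem_erase.1 hu).2 h)
        have hy' : ∀ u ∈ S.erase v, ¬ G.Adj u y := fun u hu h =>
          (mem_erase.1 hu).1 (hy u (mem_erase.1 hu).2 h)
        have hyE : y ∉ S.erase v := fun h => hyS (mem_of_mem_erase h)
        have hxE : x ∉ insert y (S.erase v) := by
          rw [mem_insert]
          rintro (h | h)
          · exact hxy h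
          · exact hxS (mem_of_mem_erase h)
        have := hmax' (insert x (insert y (S.erase v))) (by
          intro z hz
          simp only [mem_insert] at hz
          rcases hz with rfl | rfl | hz
          · exact hxA
          · exact hyA
          · exact hSA (mem_of_mem_erase hz)) (by
          intro a ha b hb hab
          simp only [coe_insert, Set.mem_insert_iff, mem_coe] at ha hb
          rcases ha with rfl | rfl | ha <;> rcases hb with rfl | rfl | hb
          · exact absurd rfl hab
          · exact hnadj
          · exact fun h => hx' b hb h.symm
          · exact fun h => hnadj h.symm
          · exact absurd rfl hab
          · exact fun h => hy' b hb h.symm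
          · exact hx' a ha
          · exact hy' a ha
          · exact hS (mem_coe.2 (mem_of_mem_erase ha)) (mem_coe.2 (mem_of_mem_erase hb)) hab)
        rw [card_insert_of_notMem hxE, card_insert_of_notMem hyE, card_erase_of_mem hv] at this
        have := card_pos.2 ⟨v, hv⟩
        omega
  have hcover : ∀ w ∈ A, (1 : ℝ) ≤ (∑ v ∈ S, if w ∈ B v then (1 : ℝ) else 0) +
      ((#{v ∈ S | G.Adj v w} : ℝ) * ((#{v ∈ S | G.Adj v w} : ℝ) - 1)) / 2 := by
    intro w hwA
    have hsum0 : (0 : ℝ) ≤ ∑ v ∈ S, if w ∈ B v then (1 : ℝ) else 0 :=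
      Finset.sum_nonneg fun v _ => by split_ifs <;> norm_num
    have hsum1 : ∀ v ∈ S, w ∈ B v → (1 : ℝ) ≤ ∑ v ∈ S, if w ∈ B v then (1 : ℝ) else 0 := by
      intro v hv hwv
      refine le_trans (by rw [if_pos hwv]) (Finset.single_le_sum
        (f := fun v => if w ∈ B v then (1 : ℝ) else 0)
        (fun v _ => by split_ifs <;> norm_num) hv)
    rcases Nat.lt_or_ge (#{v ∈ S | G.Adj v w}) 2 with h | h
    · have h0 : ((#{v ∈ S | G.Adj v w} : ℝ) * ((#{v ∈ S | G.Adj v w} : ℝ) - 1)) / 2 = 0 := by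
        interval_cases #{v ∈ S | G.Adj v w} <;> norm_num
      rw [h0, add_zero]
      by_cases hwS : w ∈ S
      · exact hsum1 w hwS (by simp [B, hwA])
      by_cases he : ∃ v ∈ S, G.Adj v w
      · obtain ⟨v, hv, hvw⟩ := he
        refine hsum1 v hv ?_
        simp only [B, mem_filter]
        refine ⟨hwA, Or.inr ⟨hvw, fun u hu huw => ?_⟩⟩
        exact Finset.card_le_one.1 (Nat.lt_succ_iff.1 h) u (mem_filter.2 ⟨hu, huw⟩) v
          (mem_filter.2 ⟨hv, hvw⟩)
      · push Not at he
        have := hmax' (insert w S) (insert_subset hwA hSA) (by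
          intro a ha b hb hab
          simp only [coe_insert, Set.mem_insert_iff, mem_coe] at ha hb
          rcases ha with rfl | ha <;> rcases hb with rfl | hb
          · exact absurd rfl hab
          · exact fun h => he b hb h.symm
          · exact he a ha
          · exact hS (mem_coe.2 ha) (mem_coe.2 hb) hab)
        rw [card_insert_of_notMem hwS] at this
        omega
    · have : (2 : ℝ) ≤ (#{v ∈ S | G.Adj v w} : ℝ) := by exact_mod_cast h
      nlinarith
  have hpair : ∀ w, (0 : ℝ) ≤
      ((#{v ∈ S | G.Adj v w} : ℝ) * ((#{v ∈ S | G.Adj v w} : ℝ) - 1)) / 2 := by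
    intro w
    rcases Nat.eq_zero_or_pos (#{v ∈ S | G.Adj v w}) with h | h
    · simp [h]
    · have : (1 : ℝ) ≤ (#{v ∈ S | G.Adj v w} : ℝ) := by exact_mod_cast h
      have : (0 : ℝ) ≤ (#{v ∈ S | G.Adj v w} : ℝ) - 1 := by linarith
      positivity
  have hA1 : (#A : ℝ) ≤ ∑ v ∈ S, (#(B v) : ℝ) + #S * ((#S : ℝ) - 1) / 2 * K := by
    calc (#A : ℝ) = ∑ w ∈ A, 1 := by simp
      _ ≤ ∑ w ∈ A, ((∑ v ∈ S, if w ∈ B v then (1 : ℝ) else 0) +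
        ((#{v ∈ S | G.Adj v w} : ℝ) * ((#{v ∈ S | G.Adj v w} : ℝ) - 1)) / 2) :=
        Finset.sum_le_sum hcover
      _ = ∑ v ∈ S, (#(B v) : ℝ) + ∑ w ∈ A,
        ((#{v ∈ S | G.Adj v w} : ℝ) * ((#{v ∈ S | G.Adj v w} : ℝ) - 1)) / 2 := by
        rw [Finset.sum_add_distrib, Finset.sum_comm]
        congr 1
        refine Finset.sum_congr rfl fun v _ => ?_
        rw [Finset.sum_ite_mem, inter_eq_right.2 (filter_subset _ _), sum_const, nsmul_eq_mul, mul_one]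
      _ ≤ ∑ v ∈ S, (#(B v) : ℝ) + ∑ w,
        ((#{v ∈ S | G.Adj v w} : ℝ) * ((#{v ∈ S | G.Adj v w} : ℝ) - 1)) / 2 := by
        gcongr
        · exact fun w _ _ => hpair w
        · exact subset_univ A
      _ ≤ _ := by
        rw [← Finset.sum_div]
        have := sum_pairs_le_of_isIndepSet hK hS
        linarith
  have hA2 : ∑ v ∈ S, (#(B v) : ℝ) ≤ #S * K := by
    simpa using Finset.sum_le_card_nsmul S _ K hB
  have hSs : (#S : ℝ) + 1 ≤ s := by exact_mod_cast hA S hSA hS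
  have h0 : (0 : ℝ) ≤ #S := Nat.cast_nonneg _
  calc (#A : ℝ) ≤ (#S + 1) * (#S) / 2 * K := by linarith
    _ ≤ s * ((s : ℝ) - 1) / 2 * K := by
      gcongr
      · linarith

theorem card_highDegree_le (hK0 : 0 ≤ K) (hω : ∀ C : Finset V, G.IsClique C → (#C : ℝ) ≤ K)
    (hK : G.NonadjCodegreeLE K) {s : ℕ} (hs : 0 < s) :
    (#{v | (Fintype.card V : ℝ) / s + ((s : ℝ) - 1) / 2 * K - 1 < G.degree v} : ℝ) ≤
      s * ((s : ℝ) - 1) / 2 * K := by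
  refine card_le_of_indepSets_lt hK0 hω hK fun I hI hind => ?_
  by_contra! hcard
  obtain ⟨S, hSI, hSs⟩ := Finset.exists_subset_card_eq hcard
  have h1 := sum_degree_le_of_isIndepSet hK (S := S) (hind.mono (coe_subset.2 hSI))
  have h2 : ∑ v ∈ S, ((Fintype.card V : ℝ) / s + ((s : ℝ) - 1) / 2 * K - 1) <
      ∑ v ∈ S, (G.degree v : ℝ) := by
    refine Finset.sum_lt_sum_of_nonempty (card_pos.1 (by omega)) fun v hv => ?_
    exact (mem_filter.1 (hI (hSI hv))).2
  rw [sum_const, nsmul_eq_mul, hSs] at h2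
  rw [hSs] at h1
  have hs' : (0 : ℝ) < s := by exact_mod_cast hs
  have : (s : ℝ) * ((Fintype.card V : ℝ) / s) = Fintype.card V := by field_simp
  nlinarith

theorem le_add_sum_layers (D c : ℕ → ℝ) (x : ℝ) (hx : x ≤ D 1) (k : ℕ)
    (hc : ∀ i < k, 0 ≤ c i) (hD : ∀ i < k, D (i + 1) - D (i + 2) ≤ c i) :
    x ≤ D (k + 1) + ∑ i ∈ range k, if D (i + 2) < x then c i else 0 := by
  induction k with
  | zero => simpa using hx
  | succ k ih =>
    have ih := ih (fun i hi => hc i (by omega)) (fun i hi => hD i (by omega))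
    rw [Finset.sum_range_succ]
    split_ifs with h
    · have := hD k (by omega)
      linarith
    · have : 0 ≤ ∑ i ∈ range k, if D (i + 2) < x then c i else 0 :=
        Finset.sum_nonneg fun i hi => by
          split_ifs
          · exact hc i (by rw [mem_range] at hi; omega)
          · exact le_rfl
      push Not at h
      linarith

theorem sum_degree_le_of_codegree (hK0 : 0 ≤ K)
    (hω : ∀ C : Finset V, G.IsClique C → (#C : ℝ) ≤ K)
    (hK : G.NonadjCodegreeLE K) (k : ℕ) :
    ∑ v, (G.degree v : ℝ) ≤
      (Fintype.card V : ℝ) * ((Fintype.card V : ℝ) / (k + 1) + k * K - 1) := by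
  set n : ℝ := (Fintype.card V : ℝ) with hn
  let D : ℕ → ℝ := fun s => n / s + ((s : ℝ) - 1) / 2 * K - 1
  let c : ℕ → ℝ := fun i => n / ((i + 1) * (i + 2))
  have hn0 : 0 ≤ n := Nat.cast_nonneg _
  have hpt : ∀ v, (G.degree v : ℝ) ≤
      D (k + 1) + ∑ i ∈ range k, if D (i + 2) < G.degree v then c i else 0 := by
    intro v
    refine le_add_sum_layers D c _ ?_ k (fun i _ => by positivity) (fun i _ => ?_)
    · have : (G.degree v : ℝ) + 1 ≤ n := by
        rw [hn]
        exact_mod_cast G.degree_lt_card_verts v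
      simp only [D]
      norm_num
      linarith
    · simp only [D, c]
      push_cast
      have : n / ((i : ℝ) + 1) - n / ((i : ℝ) + 2) = n / ((i + 1) * (i + 2)) := by
        field_simp
        ring
      linarith
  refine (Finset.sum_le_sum fun v _ => hpt v).trans ?_
  rw [Finset.sum_add_distrib, Finset.sum_comm]
  have hlayer : ∀ i ∈ range k, (∑ v, if D (i + 2) < G.degree v then c i else 0) ≤ n * K / 2 := by
    intro i _
    rw [← Finset.sum_filter, sum_const, nsmul_eq_mul]
    have h := card_highDegree_le hK0 hω hK (s := i + 2) (by omega)
    calc _ ≤ (((i + 2 : ℕ) : ℝ) * (((i + 2 : ℕ) : ℝ) - 1) / 2 * K) * c i := by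
          gcongr
      _ = n * K / 2 := by
          simp only [c]
          push_cast
          have h1 : (i : ℝ) + 1 ≠ 0 := by positivity
          have h2 : (i : ℝ) + 2 ≠ 0 := by positivity
          field_simp
          ring
  have := Finset.sum_le_card_nsmul _ _ _ hlayer
  rw [card_range, nsmul_eq_mul] at this
  rw [sum_const, nsmul_eq_mul, card_univ, ← hn]
  refine (add_le_add_right this _).trans (le_of_eq ?_)
  simp only [D]
  push_cast
  ring

theorem sq_mul_card_lt (hK0 : 1 ≤ K)
    (hω : ∀ C : Finset V, G.IsClique C → (#C : ℝ) ≤ K)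
    (hK : G.NonadjCodegreeLE K) {α : ℝ} (hα0 : 0 ≤ α) (hα1 : α ≤ 1)
    (hα : (G.edgeSet.ncard : ℝ) = α * ((Fintype.card V).choose 2 : ℝ)) :
    α ^ 2 * (Fintype.card V : ℝ) < 4 * K := by
  set n : ℝ := (Fintype.card V : ℝ) with hn
  have hn0 : 0 ≤ n := Nat.cast_nonneg _
  have hα2 : α ^ 2 ≤ 1 := pow_le_one₀ hα0 hα1
  rcases lt_or_ge n K with hnK | hnK
  · nlinarith
  have hdeg : ∑ v, (G.degree v : ℝ) = α * (n * (n - 1)) := by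
    have h1 := G.sum_degrees_eq_twice_card_edges
    have h2 : (∑ v, (G.degree v : ℝ)) = 2 * (#G.edgeFinset : ℝ) := by exact_mod_cast h1
    rw [Set.ncard_eq_toFinset_card', ← SimpleGraph.edgeFinset, Nat.cast_choose_two] at hα
    rw [h2, hα]
    ring
  have hKpos : 0 < K := by linarith
  set y : ℝ := Real.sqrt (n / K) with hy
  have hy2 : n = K * y ^ 2 := by
    rw [hy, Real.sq_sqrt (by positivity)]
    field_simp
  have hy1 : 1 ≤ y := by
    rw [hy, Real.one_le_sqrt, one_le_div hKpos]
    exact hnK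
  obtain ⟨k, hk1, hk2⟩ : ∃ k : ℕ, (k : ℝ) < y ∧ y ≤ k + 1 := by
    have h1 : 0 < ⌈y⌉₊ := Nat.ceil_pos.2 (by linarith)
    obtain ⟨k, hk⟩ := Nat.exists_eq_succ_of_ne_zero h1.ne'
    have h2 : k < ⌈y⌉₊ := by omega
    refine ⟨k, Nat.lt_ceil.1 h2, ?_⟩
    have := Nat.le_ceil y
    rw [hk] at this
    exact_mod_cast this
  have h := sum_degree_le_of_codegree hKpos.le hω hK k
  rw [hdeg, ← hn] at h
  have hnpos : 0 < n := lt_of_lt_of_le hKpos hnK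
  have h1 : α * (n - 1) ≤ n / (k + 1) + k * K - 1 := by
    refine le_of_mul_le_mul_left ?_ hnpos
    linarith
  have h2 : α * n ≤ n / (k + 1) + k * K := by linarith
  have hk0 : (0 : ℝ) < k + 1 := by positivity
  have h3 : α * y ^ 2 * (k + 1) ≤ y ^ 2 + k * (k + 1) := by
    refine le_of_mul_le_mul_left ?_ hKpos
    have : α * n * (k + 1) ≤ (n / (k + 1) + k * K) * (k + 1) := by gcongr
    rw [add_mul, div_mul_cancel₀ _ hk0.ne', hy2] at this
    linarith
  have h4 : y ^ 2 + k * (k + 1) < 2 * y * (k + 1) := by nlinarith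
  have h5 : α * y < 2 := by
    have : (α * y) * (y * (k + 1)) < 2 * (y * (k + 1)) := by linarith
    exact lt_of_mul_lt_mul_right this (by positivity)
  have h6 : (α * y) ^ 2 < 4 := by
    have : 0 ≤ α * y := by positivity
    nlinarith
  rw [hy2]
  nlinarith

end Counting

section Ramsey

open Finset
open scoped Classical

variable {V : Type*} {G : SimpleGraph V}

theorem card_lt_choose_of_clique_indep (a b : ℕ) (A : Finset V)
    (hC : ∀ C ⊆ A, G.IsClique C → #C ≤ a) (hI : ∀ I ⊆ A, G.IsIndepSet I → #I ≤ b) :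
    #A < (a + b).choose a := by
  induction hm : a + b generalizing a b A with
  | zero =>
    obtain ⟨rfl, rfl⟩ : a = 0 ∧ b = 0 := by omega
    have hA : A = ∅ := by
      by_contra hne
      obtain ⟨v, hv⟩ := Finset.nonempty_iff_ne_empty.2 hne
      simpa using hC {v} (by simpa using hv) (by simp)
    simp [hA]
  | succ m ih =>
    rcases A.eq_empty_or_nonempty with rfl | ⟨v, hv⟩
    · simpa using Nat.choose_pos (by omega)
    have ha : 1 ≤ a := by simpa using hC {v} (by simpa using hv) (by simp)
    have hb : 1 ≤ b := by simpa using hI {v} (by simpa using hv) (by simp [SimpleGraph.IsIndepSet])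
    obtain ⟨a, rfl⟩ := Nat.exists_eq_add_of_le' ha
    obtain ⟨b, rfl⟩ := Nat.exists_eq_add_of_le' hb
    have h1 := ih a (b + 1) {w ∈ A.erase v | G.Adj v w} (fun C hCs hCc => by
        have hvC : v ∉ C := fun h => (mem_erase.1 (mem_filter.1 (hCs h)).1).1 rfl
        have := hC (insert v C) (insert_subset hv fun x hx =>
          mem_of_mem_erase (mem_filter.1 (hCs hx)).1) (by
          rw [coe_insert]
          exact hCc.insert fun w hw _ => (mem_filter.1 (hCs hw)).2)
        rw [card_insert_of_notMem hvC] at this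
        omega)
      (fun I hIs hIi => hI I (fun x hx => mem_of_mem_erase (mem_filter.1 (hIs hx)).1) hIi)
      (by omega)
    have h2 := ih (a + 1) b {w ∈ A.erase v | ¬ G.Adj v w}
      (fun C hCs hCc => hC C (fun x hx => mem_of_mem_erase (mem_filter.1 (hCs hx)).1) hCc)
      (fun I hIs hIi => by
        have hvI : v ∉ I := fun h => (mem_erase.1 (mem_filter.1 (hIs h)).1).1 rfl
        have := hI (insert v I) (insert_subset hv fun x hx =>
          mem_of_mem_erase (mem_filter.1 (hIs hx)).1) (by
          rw [coe_insert]
          refine Set.Pairwise.insert hIi fun w hw _ => ?_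
          have := (mem_filter.1 (hIs hw)).2
          exact ⟨this, fun h => this h.symm⟩)
        rw [card_insert_of_notMem hvI] at this
        omega)
      (by omega)
    have h3 := Finset.card_filter_add_card_filter_not (s := A.erase v) (fun w => G.Adj v w)
    rw [card_erase_of_mem hv] at h3
    rw [show m + 1 = (m + 1 - 1) + 1 by omega, Nat.choose_succ_succ', Nat.add_sub_cancel]
    have := card_pos.2 ⟨v, hv⟩
    omega

end Ramsey

section HardCore

open Finset
open scoped Classical

/-- The independent sets of `F` inside `A`. -/
noncomputable def indepFamily {V : Type*} (F : SimpleGraph V) (A : Finset V) : Finset (Finset V) :=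
  A.powerset.filter fun I => F.IsIndepSet (I : Set V)

/-- The partition function of the hard-core model on `F[A]` with fugacity `lam`. -/
noncomputable def hardCoreZ {V : Type*} (F : SimpleGraph V) (lam : ℝ) (A : Finset V) : ℝ :=
  ∑ I ∈ indepFamily F A, lam ^ #I

variable {V : Type*} {F : SimpleGraph V} {lam : ℝ}

theorem mem_indepFamily {A I : Finset V} :
    I ∈ indepFamily F A ↔ I ⊆ A ∧ F.IsIndepSet (I : Set V) := by
  simp [indepFamily]

theorem one_le_hardCoreZ (hl : 0 < lam) (A : Finset V) : 1 ≤ hardCoreZ F lam A := by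
  have h : ∅ ∈ indepFamily F A := by simp [mem_indepFamily, SimpleGraph.IsIndepSet]
  have := Finset.single_le_sum (f := fun I : Finset V => lam ^ #I)
    (fun I _ => by positivity) h
  rw [hardCoreZ]
  simpa using this

theorem hardCoreZ_mono (hl : 0 < lam) {A B : Finset V} (h : A ⊆ B) :
    hardCoreZ F lam A ≤ hardCoreZ F lam B := by
  refine Finset.sum_le_sum_of_subset_of_nonneg (fun I hI => ?_) fun I _ _ => by positivity
  rw [mem_indepFamily] at hI ⊢
  exact ⟨hI.1.trans h, hI.2⟩

theorem isIndepSet_insert {I : Finset V} {u : V} (hI : F.IsIndepSet (I : Set V))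
    (h : ∀ w ∈ I, ¬ F.Adj u w) : F.IsIndepSet ((insert u I : Finset V) : Set V) := by
  rw [coe_insert]
  exact Set.Pairwise.insert hI fun w hw _ => ⟨h w hw, fun h' => h w hw h'.symm⟩

theorem sum_indepFamily_mem (A : Finset V) {u : V} (hu : u ∈ A) :
    ∑ I ∈ indepFamily F A with u ∈ I, lam ^ #I =
      lam * hardCoreZ F lam {w ∈ A | w ≠ u ∧ ¬ F.Adj u w} := by
  rw [hardCoreZ, Finset.mul_sum]
  refine Finset.sum_bij' (fun I _ => I.erase u) (fun I _ => insert u I) ?_ ?_ ?_ ?_ ?_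
  · intro I hI
    rw [mem_filter, mem_indepFamily] at hI
    rw [mem_indepFamily]
    refine ⟨fun w hw => ?_, hI.1.2.mono (by simp)⟩
    rw [mem_erase] at hw
    rw [mem_filter]
    exact ⟨hI.1.1 hw.2, hw.1, hI.1.2 (mem_coe.2 hI.2) (mem_coe.2 hw.2) (Ne.symm hw.1)⟩
  · intro I hI
    rw [mem_indepFamily] at hI
    rw [mem_filter, mem_indepFamily]
    exact ⟨⟨insert_subset hu fun w hw => (mem_filter.1 (hI.1 hw)).1,
      isIndepSet_insert hI.2 fun w hw => (mem_filter.1 (hI.1 hw)).2.2⟩, mem_insert_self _ _⟩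
  · intro I hI
    exact insert_erase (mem_filter.1 hI).2
  · intro I hI
    rw [mem_indepFamily] at hI
    exact erase_insert fun h => (mem_filter.1 (hI.1 h)).2.1 rfl
  · intro I hI
    rw [← pow_succ', card_erase_add_one (mem_filter.1 hI).2]

theorem hardCoreZ_le_erase (hl : 0 < lam) (A : Finset V) (u : V) :
    hardCoreZ F lam A ≤ (1 + lam) * hardCoreZ F lam (A.erase u) := by
  by_cases hu : u ∈ A
  · have h1 := Finset.sum_filter_add_sum_filter_not (indepFamily F A) (fun I => u ∈ I)
      (fun I => lam ^ #I)
    rw [sum_indepFamily_mem A hu] at h1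
    have h2 : (indepFamily F A).filter (fun I => ¬ u ∈ I) = indepFamily F (A.erase u) := by
      ext I
      rw [mem_filter, mem_indepFamily, mem_indepFamily, subset_erase]
      tauto
    rw [h2] at h1
    have h3 : hardCoreZ F lam {w ∈ A | w ≠ u ∧ ¬ F.Adj u w} ≤ hardCoreZ F lam (A.erase u) := by
      refine hardCoreZ_mono hl fun w hw => ?_
      rw [mem_filter] at hw
      exact mem_erase.2 ⟨hw.2.1, hw.1⟩
    have h4 := mul_le_mul_of_nonneg_left h3 hl.le
    rw [hardCoreZ, ← h1]
    change _ + hardCoreZ F lam _ ≤ _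
    linarith
  · rw [erase_eq_of_notMem hu]
    have := one_le_hardCoreZ (F := F) hl A
    nlinarith

theorem hardCoreZ_le_sdiff (hl : 0 < lam) (A Y : Finset V) :
    hardCoreZ F lam A ≤ (1 + lam) ^ #Y * hardCoreZ F lam (A \ Y) := by
  induction Y using Finset.induction_on with
  | empty => simp
  | insert u Y hu ih =>
    rw [card_insert_of_notMem hu, sdiff_insert, pow_succ, mul_assoc]
    refine ih.trans ?_
    gcongr
    exact hardCoreZ_le_erase hl _ _

theorem hardCoreZ_le_pow (hl : 0 < lam) (A : Finset V) :
    hardCoreZ F lam A ≤ (1 + lam) ^ #A := by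
  have h := hardCoreZ_le_sdiff (F := F) hl A A
  have h0 : hardCoreZ F lam (∅ : Finset V) = 1 := by
    have : indepFamily F ∅ = {∅} := by
      ext I
      rw [mem_indepFamily, subset_empty, mem_singleton]
      exact ⟨fun h => h.1, fun h => ⟨h, by simp [h, SimpleGraph.IsIndepSet]⟩⟩
    simp [hardCoreZ, this]
  rwa [sdiff_self, bot_eq_empty, h0, mul_one] at h

theorem sum_card_mul_ge (hl : 0 < lam) (X : Finset V) (h : ℕ)
    (hX : ∀ u ∈ X, #{w ∈ X | F.Adj u w} ≤ h) :
    #X * lam * hardCoreZ F lam X / (1 + lam) ^ (h + 1) ≤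
      ∑ I ∈ indepFamily F X, lam ^ #I * #I := by
  have h1 : ∑ I ∈ indepFamily F X, lam ^ #I * #I =
      ∑ u ∈ X, ∑ I ∈ indepFamily F X with u ∈ I, lam ^ #I := by
    simp_rw [Finset.sum_filter]
    rw [Finset.sum_comm]
    refine Finset.sum_congr rfl fun I hI => ?_
    rw [Finset.sum_ite_mem, inter_eq_right.2 (mem_indepFamily.1 hI).1, sum_const, nsmul_eq_mul,
      mul_comm]
  rw [h1]
  have h2 : ∀ u ∈ X, lam * hardCoreZ F lam X / (1 + lam) ^ (h + 1) ≤
      ∑ I ∈ indepFamily F X with u ∈ I, lam ^ #I := by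
    intro u hu
    rw [sum_indepFamily_mem X hu]
    have h3 := hardCoreZ_le_sdiff (F := F) hl X (insert u {w ∈ X | F.Adj u w})
    have h4 : X \ insert u {w ∈ X | F.Adj u w} = {w ∈ X | w ≠ u ∧ ¬ F.Adj u w} := by
      ext w
      simp only [mem_sdiff, mem_insert, mem_filter]
      tauto
    rw [h4] at h3
    have h5 : #(insert u {w ∈ X | F.Adj u w}) ≤ h + 1 :=
      (card_insert_le _ _).trans (by have := hX u hu; omega)
    have h6 : (1 + lam) ^ #(insert u {w ∈ X | F.Adj u w}) ≤ (1 + lam) ^ (h + 1) :=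
      pow_le_pow_right₀ (by linarith) h5
    rw [mul_div_assoc]
    gcongr
    rw [div_le_iff₀ (by positivity), mul_comm]
    refine h3.trans ?_
    gcongr
    exact zero_le_one.trans (one_le_hardCoreZ hl _)
  have := Finset.card_nsmul_le_sum _ _ _ h2
  rw [nsmul_eq_mul] at this
  refine le_trans (le_of_eq ?_) this
  ring

/-- Grouping the independent sets of `A` by their trace outside the closed neighbourhood of `v`. -/
theorem sum_indepFamily_fiber (A : Finset V) {v : V} (hv : v ∈ A) {J : Finset V}
    (hJ : J ∈ indepFamily F {w ∈ A | w ≠ v ∧ ¬ F.Adj v w}) (g : Finset V → ℝ) :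
    ∑ I ∈ indepFamily F A with I.filter (fun w => w ≠ v ∧ ¬ F.Adj v w) = J, g I =
      g (insert v J) +
        ∑ I ∈ indepFamily F {u ∈ A | F.Adj v u ∧ ∀ w ∈ J, ¬ F.Adj u w}, g (J ∪ I) := by
  rw [mem_indepFamily] at hJ
  obtain ⟨hJs, hJi⟩ := hJ
  have hJ' : ∀ w ∈ J, w ∈ A ∧ w ≠ v ∧ ¬ F.Adj v w := fun w hw => mem_filter.1 (hJs hw)
  rw [← Finset.sum_filter_add_sum_filter_not _ (fun I => v ∈ I)]
  congr 1
  · rw [← Finset.sum_singleton g (insert v J)]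
    refine Finset.sum_congr ?_ fun _ _ => rfl
    ext I
    rw [mem_filter, mem_filter, mem_indepFamily, mem_singleton]
    constructor
    · rintro ⟨⟨⟨hIA, hI⟩, rfl⟩, hvI⟩
      ext w
      rw [mem_insert, mem_filter]
      constructor
      · intro hw
        by_cases hwv : w = v
        · exact Or.inl hwv
        · exact Or.inr ⟨hw, hwv, hI (mem_coe.2 hvI) (mem_coe.2 hw) (Ne.symm hwv)⟩
      · rintro (rfl | hw)
        · exact hvI
        · exact hw.1
    · rintro rfl
      refine ⟨⟨⟨insert_subset hv fun w hw => (hJ' w hw).1,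
        isIndepSet_insert hJi fun w hw => (hJ' w hw).2.2⟩, ?_⟩, mem_insert_self _ _⟩
      ext w
      rw [mem_filter, mem_insert]
      constructor
      · rintro ⟨h1 | h1, h2⟩
        · exact absurd h1 h2.1
        · exact h1
      · intro hw
        exact ⟨Or.inr hw, (hJ' w hw).2⟩
  · refine Finset.sum_bij' (fun I _ => I.filter fun w => F.Adj v w) (fun I _ => J ∪ I)
      ?_ ?_ ?_ ?_ ?_
    · intro I hI
      rw [mem_filter, mem_filter, mem_indepFamily] at hI
      obtain ⟨⟨⟨hIA, hI⟩, rfl⟩, hvI⟩ := hI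
      rw [mem_indepFamily]
      refine ⟨fun u hu => ?_, hI.mono (coe_subset.2 (filter_subset _ _))⟩
      rw [mem_filter] at hu ⊢
      refine ⟨hIA hu.1, hu.2, fun w hw huw => ?_⟩
      exact hI (mem_coe.2 hu.1) (mem_coe.2 (mem_filter.1 hw).1) huw.ne huw
    · intro I hI
      rw [mem_indepFamily] at hI
      obtain ⟨hIs, hI⟩ := hI
      have hI' : ∀ u ∈ I, u ∈ A ∧ F.Adj v u ∧ ∀ w ∈ J, ¬ F.Adj u w :=
        fun u hu => mem_filter.1 (hIs hu)
      rw [mem_filter, mem_filter, mem_indepFamily]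
      refine ⟨⟨⟨union_subset (fun w hw => (hJ' w hw).1) fun u hu => (hI' u hu).1, ?_⟩, ?_⟩, ?_⟩
      · intro x hx y hy hxy
        rw [mem_coe, mem_union] at hx hy
        rcases hx with hx | hx <;> rcases hy with hy | hy
        · exact hJi (mem_coe.2 hx) (mem_coe.2 hy) hxy
        · exact fun h => (hI' y hy).2.2 x hx h.symm
        · exact (hI' x hx).2.2 y hy
        · exact hI (mem_coe.2 hx) (mem_coe.2 hy) hxy
      · ext w
        rw [mem_filter, mem_union]
        constructor
        · rintro ⟨h1 | h1, h2⟩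
          · exact h1
          · exact absurd (hI' w h1).2.1 h2.2
        · intro hw
          exact ⟨Or.inl hw, (hJ' w hw).2⟩
      · rw [mem_union]
        rintro (h | h)
        · exact (hJ' v h).2.1 rfl
        · exact (hI' v h).2.1.ne rfl
    · intro I hI
      rw [mem_filter, mem_filter, mem_indepFamily] at hI
      obtain ⟨⟨⟨hIA, hI⟩, rfl⟩, hvI⟩ := hI
      ext w
      rw [mem_union, mem_filter, mem_filter]
      constructor
      · rintro (h | h)
        · exact h.1
        · exact h.1
      · intro hw
        by_cases h : F.Adj v w
        · exact Or.inr ⟨hw, h⟩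
        · exact Or.inl ⟨hw, fun h' => hvI (h' ▸ hw), h⟩
    · intro I hI
      rw [mem_indepFamily] at hI
      ext w
      rw [mem_filter, mem_union]
      constructor
      · rintro ⟨h1 | h1, h2⟩
        · exact absurd h2 (hJ' w h1).2.2
        · exact h1
      · intro hw
        exact ⟨Or.inr hw, (mem_filter.1 (hI.1 hw)).2.1⟩
    · intro I hI
      rw [mem_filter, mem_filter] at hI
      obtain ⟨⟨_, rfl⟩, hvI⟩ := hI
      congr 1
      ext w
      rw [mem_union, mem_filter, mem_filter]
      constructor
      · intro hw
        by_cases h : F.Adj v w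
        · exact Or.inr ⟨hw, h⟩
        · exact Or.inl ⟨hw, fun h' => hvI (h' ▸ hw), h⟩
      · rintro (h | h)
        · exact h.1
        · exact h.1

theorem local_occupancy_ge {a m : ℝ} {h : ℕ} (hl : 0 < lam)
    (hloc : ∀ (x : ℕ) (Z : ℝ), 1 ≤ Z → Z ≤ (1 + lam) ^ x →
      m * (lam + Z) ≤ a * lam + x * lam * Z / (1 + lam) ^ (h + 1))
    (A : Finset V) {v : V} (hv : v ∈ A)
    (hcodeg : ∀ u ∈ A, F.Adj v u → #{w ∈ A | F.Adj v w ∧ F.Adj u w} ≤ h) :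
    m * hardCoreZ F lam A ≤ ∑ I ∈ indepFamily F A,
      lam ^ #I * ((if v ∈ I then a else 0) + #{u ∈ I | F.Adj v u}) := by
  have hmaps : ∀ I ∈ indepFamily F A, I.filter (fun w => w ≠ v ∧ ¬ F.Adj v w) ∈
      indepFamily F {w ∈ A | w ≠ v ∧ ¬ F.Adj v w} := by
    intro I hI
    rw [mem_indepFamily] at hI ⊢
    exact ⟨filter_subset_filter _ hI.1, hI.2.mono (coe_subset.2 (filter_subset _ _))⟩
  rw [hardCoreZ, ← Finset.sum_fiberwise_of_maps_to hmaps, Finset.mul_sum,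
    ← Finset.sum_fiberwise_of_maps_to hmaps]
  refine Finset.sum_le_sum fun J hJ => ?_
  rw [sum_indepFamily_fiber A hv hJ, sum_indepFamily_fiber A hv hJ]
  rw [mem_indepFamily] at hJ
  have hJ' : ∀ w ∈ J, w ∈ A ∧ w ≠ v ∧ ¬ F.Adj v w := fun w hw => mem_filter.1 (hJ.1 hw)
  have hvJ : v ∉ J := fun h => (hJ' v h).2.1 rfl
  set X : Finset V := {u ∈ A | F.Adj v u ∧ ∀ w ∈ J, ¬ F.Adj u w} with hX
  have hXm : ∀ I ∈ indepFamily F X, ∀ u ∈ I, u ∈ A ∧ F.Adj v u ∧ ∀ w ∈ J, ¬ F.Adj u w :=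
    fun I hI u hu => mem_filter.1 ((mem_indepFamily.1 hI).1 hu)
  have hcard : ∀ I ∈ indepFamily F X, #(J ∪ I) = #J + #I := fun I hI =>
    card_union_of_disjoint (disjoint_left.2 fun w hw hw' =>
      (hJ' w hw).2.2 (hXm I hI w hw').2.1)
  have e1 : ∑ I ∈ indepFamily F X, lam ^ #(J ∪ I) = lam ^ #J * hardCoreZ F lam X := by
    rw [hardCoreZ, Finset.mul_sum]
    exact Finset.sum_congr rfl fun I hI => by rw [hcard I hI, pow_add]
  have e2 : ∑ I ∈ indepFamily F X, lam ^ #(J ∪ I) *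
      ((if v ∈ J ∪ I then a else 0) + (#{u ∈ J ∪ I | F.Adj v u} : ℝ)) =
      lam ^ #J * ∑ I ∈ indepFamily F X, lam ^ #I * #I := by
    rw [Finset.mul_sum]
    refine Finset.sum_congr rfl fun I hI => ?_
    have h1 : v ∉ J ∪ I := by
      rw [mem_union]
      rintro (h | h)
      · exact hvJ h
      · exact (hXm I hI v h).2.1.ne rfl
    have h2 : ({u ∈ J ∪ I | F.Adj v u} : Finset V) = I := by
      ext w
      rw [mem_filter, mem_union]
      constructor
      · rintro ⟨h1 | h1, h2⟩
        · exact absurd h2 (hJ' w h1).2.2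
        · exact h1
      · exact fun hw => ⟨Or.inr hw, (hXm I hI w hw).2.1⟩
    rw [if_neg h1, h2, hcard I hI, pow_add]
    ring
  have e3 : ({u ∈ insert v J | F.Adj v u} : Finset V) = ∅ := by
    refine filter_eq_empty_iff.2 fun w hw hvw => ?_
    rcases mem_insert.1 hw with rfl | hw
    · exact hvw.ne rfl
    · exact (hJ' w hw).2.2 hvw
  rw [e1, e2, e3, if_pos (mem_insert_self _ _), card_insert_of_notMem hvJ, card_empty, pow_succ]
  have h1 := hloc #X (hardCoreZ F lam X) (one_le_hardCoreZ hl X) (hardCoreZ_le_pow hl X)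
  have h2 := sum_card_mul_ge (F := F) hl X h (fun u hu => by
    refine (card_le_card fun w hw => ?_).trans
      (hcodeg u (mem_filter.1 hu).1 (mem_filter.1 hu).2.1)
    rw [mem_filter] at hw ⊢
    exact ⟨(mem_filter.1 hw.1).1, (mem_filter.1 hw.1).2.1, hw.2⟩)
  have h3 := mul_le_mul_of_nonneg_left (h1.trans (add_le_add_right h2 _))
    (show 0 ≤ lam ^ #J by positivity)
  push_cast
  linarith

theorem mul_card_le_of_sparse {a m Δ s : ℝ} {h : ℕ} (hl : 0 < lam) (haΔ : 0 ≤ a + Δ)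
    (hloc : ∀ (x : ℕ) (Z : ℝ), 1 ≤ Z → Z ≤ (1 + lam) ^ x →
      m * (lam + Z) ≤ a * lam + x * lam * Z / (1 + lam) ^ (h + 1))
    (A : Finset V) (hdeg : ∀ v ∈ A, (#{w ∈ A | F.Adj v w} : ℝ) ≤ Δ)
    (hcodeg : ∀ v ∈ A, ∀ u ∈ A, F.Adj v u → #{w ∈ A | F.Adj v w ∧ F.Adj u w} ≤ h)
    (hind : ∀ I ⊆ A, F.IsIndepSet (I : Set V) → (#I : ℝ) ≤ s) :
    m * #A ≤ (a + Δ) * s := by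
  have h1 := Finset.sum_le_sum fun v hv => local_occupancy_ge hl hloc A hv (hcodeg v hv)
  rw [Finset.sum_comm, sum_const, nsmul_eq_mul] at h1
  have h2 : ∀ I ∈ indepFamily F A, (∑ v ∈ A, lam ^ #I *
      ((if v ∈ I then a else 0) + (#{u ∈ I | F.Adj v u} : ℝ))) ≤ lam ^ #I * ((a + Δ) * s) := by
    intro I hI
    rw [mem_indepFamily] at hI
    rw [← Finset.mul_sum]
    refine mul_le_mul_of_nonneg_left ?_ (by positivity)
    rw [Finset.sum_add_distrib, Finset.sum_ite_mem, inter_eq_right.2 hI.1, sum_const,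
      nsmul_eq_mul]
    have h3 : ∑ v ∈ A, (#{u ∈ I | F.Adj v u} : ℝ) = ∑ u ∈ I, (#{w ∈ A | F.Adj u w} : ℝ) := by
      simp_rw [Finset.card_filter, Nat.cast_sum]
      rw [Finset.sum_comm]
      simp_rw [F.adj_comm]
    rw [h3]
    have h4 := Finset.sum_le_card_nsmul I _ Δ fun u hu => hdeg u (hI.1 hu)
    rw [nsmul_eq_mul] at h4
    have h5 := mul_le_mul_of_nonneg_left (hind I hI.1 hI.2) haΔ
    linarith
  have h3 := h1.trans (Finset.sum_le_sum h2)
  rw [← Finset.sum_mul] at h3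
  change _ ≤ hardCoreZ F lam A * _ at h3
  have h4 := one_le_hardCoreZ (F := F) hl A
  refine le_of_mul_le_mul_left ?_ (show 0 < hardCoreZ F lam A by linarith)
  linarith

end HardCore

section LogRamsey

open Finset
open scoped Classical

theorem occupancy_bound_of_log {L lam B : ℝ} {h : ℕ} (hL : 20 ≤ L) (hB : 1 ≤ B) (hhB : (h : ℝ) ≤ B)
    (hlam : lam = 1 / ((h : ℝ) + 1)) (x : ℕ) (Z : ℝ) (hZ1 : 1 ≤ Z) (hZ : Z ≤ (1 + lam) ^ x) :
    L / 10 * (lam + Z) ≤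
      20 * Real.exp L / L * B * lam + x * lam * Z / (1 + lam) ^ (h + 1) := by
  have hh : (0 : ℝ) < (h : ℝ) + 1 := by positivity
  have hl0 : 0 < lam := by rw [hlam]; positivity
  have hl1 : lam ≤ 1 := by
    rw [hlam, div_le_one hh]
    linarith [(Nat.cast_nonneg h : (0 : ℝ) ≤ h)]
  have hexp : ∀ k : ℕ, (1 + lam) ^ k ≤ Real.exp (k * lam) := by
    intro k
    rw [Real.exp_nat_mul]
    gcongr
    linarith [Real.add_one_le_exp lam]
  have he : (1 + lam) ^ (h + 1) ≤ 3 := by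
    refine (hexp (h + 1)).trans ?_
    have : ((h + 1 : ℕ) : ℝ) * lam = 1 := by
      rw [hlam]
      push_cast
      field_simp
    rw [this]
    linarith [Real.exp_one_lt_d9]
  have hLpos : 0 < L := by linarith
  have hf1 : 0 ≤ 20 * Real.exp L / L * B * lam := by positivity
  have hf2 : x * lam * Z / 3 ≤ x * lam * Z / (1 + lam) ^ (h + 1) := by gcongr
  have hf3 : 0 ≤ x * lam * Z := by positivity
  rcases le_or_gt (3 / 5 * L) (x * lam) with hx | hx
  · have : 3 / 5 * L * Z ≤ x * lam * Z := by gcongr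
    nlinarith
  · have hZ' : Z ≤ Real.exp (3 / 5 * L) :=
      (hZ.trans (hexp x)).trans (Real.exp_le_exp.2 hx.le)
    have hBl : 1 / 2 ≤ B * lam := by
      rw [hlam, mul_one_div, div_le_div_iff₀ (by norm_num) hh]
      linarith
    have hq := Real.quadratic_le_exp_of_nonneg (x := 2 / 5 * L) (by positivity)
    have hq' : L ^ 2 ≤ 50 * Real.exp (2 / 5 * L) := by nlinarith
    have hmul : Real.exp L = Real.exp (2 / 5 * L) * Real.exp (3 / 5 * L) := by
      rw [← Real.exp_add]
      ring_nf
    have h1 : L / 10 * (lam + Z) ≤ L / 5 * Real.exp (3 / 5 * L) := by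
      have : L / 10 * (lam + Z) ≤ L / 10 * (2 * Real.exp (3 / 5 * L)) := by
        gcongr
        linarith
      linarith
    have h2 : L / 5 * Real.exp (3 / 5 * L) ≤ 10 * Real.exp L / L := by
      rw [le_div_iff₀ hLpos, hmul]
      have := mul_le_mul_of_nonneg_right hq' (Real.exp_pos (3 / 5 * L)).le
      linarith
    have h3 : 10 * Real.exp L / L ≤ 20 * Real.exp L / L * B * lam := by
      have : 20 * Real.exp L / L * (1 / 2) ≤ 20 * Real.exp L / L * (B * lam) := by gcongr
      calc 10 * Real.exp L / L = 20 * Real.exp L / L * (1 / 2) := by ring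
        _ ≤ _ := this
        _ = _ := by ring
    have h4 : 0 ≤ x * lam * Z / (1 + lam) ^ (h + 1) := by positivity
    linarith

variable {V : Type*} {F : SimpleGraph V}

theorem one_le_ratio {s L : ℝ} (hs : 0 < s) (hL : L = Real.log s) (hL0 : 20 ≤ L) :
    1 ≤ 20 * s / L := by
  rw [one_le_div (by linarith), hL]
  linarith [Real.log_le_sub_one_of_pos hs]

theorem clique_filter_adj_card_le {A : Finset V} {v : V} {j : ℕ} (hv : v ∈ A)
    (hC : ∀ C ⊆ A, F.IsClique C → #C ≤ j + 1) :
    ∀ C ⊆ {w ∈ A | F.Adj v w}, F.IsClique C → #C ≤ j := by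
  intro C hCs hCc
  have hvC : v ∉ C := fun h => (mem_filter.1 (hCs h)).2.ne rfl
  have := hC (insert v C) (insert_subset hv fun x hx => (mem_filter.1 (hCs hx)).1) (by
    rw [coe_insert]
    exact hCc.insert fun w hw _ => (mem_filter.1 (hCs hw)).2)
  rw [card_insert_of_notMem hvC] at this
  omega

theorem card_le_log_ramsey {s L : ℝ} (hs : 0 < s) (hL : L = Real.log s) (hL0 : 20 ≤ L) (j : ℕ)
    (A : Finset V) (hC : ∀ C ⊆ A, F.IsClique C → #C ≤ j)
    (hI : ∀ I ⊆ A, F.IsIndepSet I → (#I : ℝ) ≤ s) :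
    (#A : ℝ) ≤ (20 * s / L) ^ j * (L / 20) := by
  have hLpos : 0 < L := by linarith
  have hsub : ∀ v ∈ A, ∀ I ⊆ {w ∈ A | F.Adj v w}, F.IsIndepSet (I : Set V) → (#I : ℝ) ≤ s :=
    fun v _ I hIs hIi => hI I (hIs.trans (filter_subset _ _)) hIi
  induction j using Nat.strong_induction_on generalizing A with
  | _ j ih =>
    match j, ih, hC with
    | 0, _, hC =>
      have hA : A = ∅ := by
        by_contra hne
        obtain ⟨v, hv⟩ := Finset.nonempty_iff_ne_empty.2 hne
        simpa using hC {v} (by simpa using hv) (by simp)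
      rw [hA]
      simp
      positivity
    | 1, _, hC =>
      have h1 : (20 * s / L) ^ 1 * (L / 20) = s := by field_simp
      rw [h1]
      refine hI A Subset.rfl fun x hx y hy hxy hadj => ?_
      have := hC {x, y} (insert_subset hx (by simpa using hy)) (by
        rw [coe_insert, coe_singleton]
        exact SimpleGraph.isClique_pair.2 fun _ => hadj)
      rw [card_pair hxy] at this
      omega
    | j + 2, ih, hC =>
      set q : ℝ := 20 * s / L with hq
      have hq1 : 1 ≤ q := one_le_ratio hs hL hL0
      set B : ℝ := q ^ j * (L / 20) with hB
      have hB1 : 1 ≤ B := one_le_mul_of_one_le_of_one_le (one_le_pow₀ hq1) (by linarith)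
      have hdeg : ∀ v ∈ A, (#{w ∈ A | F.Adj v w} : ℝ) ≤ q * B := by
        intro v hv
        have := ih (j + 1) (by omega) {w ∈ A | F.Adj v w} (clique_filter_adj_card_le hv hC)
          (hsub v hv) (fun u hu I hIs hIi => hsub v hv I (hIs.trans (filter_subset _ _)) hIi)
        rwa [pow_succ', mul_assoc, ← hB] at this
      have hcodeg : ∀ v ∈ A, ∀ u ∈ A, F.Adj v u →
          #{w ∈ A | F.Adj v w ∧ F.Adj u w} ≤ ⌊B⌋₊ := by
        intro v hv u hu hvu
        refine Nat.le_floor ?_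
        rw [← filter_filter]
        have hu' : u ∈ {w ∈ A | F.Adj v w} := mem_filter.2 ⟨hu, hvu⟩
        have hind : ∀ I ⊆ {w ∈ ({w ∈ A | F.Adj v w} : Finset V) | F.Adj u w},
            F.IsIndepSet (I : Set V) → (#I : ℝ) ≤ s := fun I hIs hIi =>
          hsub v hv I (hIs.trans (filter_subset _ _)) hIi
        exact ih j (by omega) _
          (clique_filter_adj_card_le hu' (clique_filter_adj_card_le hv hC)) hind
          (fun z hz I hIs hIi => hind I (hIs.trans (filter_subset _ _)) hIi)
      have hexp : Real.exp L = s := by rw [hL, Real.exp_log hs]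
      have hmain := mul_card_le_of_sparse (F := F) (lam := 1 / ((⌊B⌋₊ : ℝ) + 1)) (a := q * B)
        (m := L / 10) (Δ := q * B) (s := s) (h := ⌊B⌋₊) (by positivity) (by positivity)
        (fun x Z h1 h2 => by
          have := occupancy_bound_of_log hL0 hB1 (Nat.floor_le (by linarith)) rfl x Z h1 h2
          rwa [hexp] at this)
        A hdeg hcodeg hI
      have : q ^ (j + 2) * (L / 20) = (q * B + q * B) * s / (L / 10) := by
        rw [hB, pow_succ, pow_succ]
        nth_rewrite 2 [hq]
        field_simp
        ring
      rw [this, le_div_iff₀ (by positivity)]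
      linarith

end LogRamsey

section InducedBipartite

open Finset
open scoped Classical

variable {V : Type*} {G : SimpleGraph V}

theorem card_lt_of_not_isIndContained {t : ℕ}
    (hG : ¬ SimpleGraph.IsIndContained (completeBipartiteGraph (Fin 2) (Fin t)) G)
    {u v : V} (huv : u ≠ v) (hnadj : ¬ G.Adj u v) {I : Finset V}
    (hI : G.IsIndepSet (I : Set V)) (hadj : ∀ w ∈ I, G.Adj u w ∧ G.Adj v w) : #I < t := by
  by_contra! hcard
  obtain ⟨J, hJI, hJt⟩ := Finset.exists_subset_card_eq hcard
  have e : Fin t ≃ J := (Fintype.equivFinOfCardEq (by simpa using hJt)).symm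
  have hJm : ∀ i, (e i : V) ∈ I := fun i => hJI (e i).2
  let p : Fin 2 → V := ![u, v]
  have hp : ∀ i k, G.Adj (p i) (e k) := by
    intro i k
    fin_cases i
    · exact (hadj _ (hJm k)).1
    · exact (hadj _ (hJm k)).2
  have hpp : ∀ i k, ¬ G.Adj (p i) (p k) := by
    intro i k
    fin_cases i <;> fin_cases k
    · exact G.irrefl
    · exact hnadj
    · exact fun h => hnadj h.symm
    · exact G.irrefl
  have hpinj : Function.Injective p := by
    intro i k hik
    fin_cases i <;> fin_cases k
    · rfl
    · exact absurd hik huv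
    · exact absurd hik.symm huv
    · rfl
  refine hG ⟨⟨⟨Sum.elim p fun k => (e k : V), ?_⟩, ?_⟩⟩
  · rintro (i | i) (k | k) h
    · exact congrArg _ (hpinj h)
    · exact absurd h (hp i k).ne
    · exact absurd h (hp k i).ne'
    · exact congrArg _ (e.injective (Subtype.ext h))
  · rintro (i | i) (k | k)
    · exact iff_of_false (hpp i k) (by simp)
    · exact iff_of_true (hp i k) (by simp)
    · exact iff_of_true (hp k i).symm (by simp)
    · have : ¬ G.Adj (e i : V) (e k : V) := fun h =>
        hI (mem_coe.2 (hJm i)) (mem_coe.2 (hJm k)) h.ne h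
      exact iff_of_false this (by simp)

end InducedBipartite

section CodegreeBounds

open Finset
open scoped Classical

variable {V : Type*} [Fintype V] {G : SimpleGraph V} {r : ℕ}

theorem nonadjCodegreeLE_choose
    (hG : ¬ SimpleGraph.IsIndContained (completeBipartiteGraph (Fin 2) (Fin (r + 1))) G) {b : ℕ}
    (hb : G.cliqueNum = b + 1) : G.NonadjCodegreeLE ((b + r).choose r) := by
  intro u v huv hnadj
  have h := card_lt_choose_of_clique_indep (G := G) b r {w | G.Adj u w ∧ G.Adj v w}
    (fun C hCs hCc => by
      have hu : ∀ w ∈ C, G.Adj u w := fun w hw => (mem_filter.1 (hCs hw)).2.1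
      have huC : u ∉ C := fun h => (hu u h).ne rfl
      have hins : G.IsClique ((insert u C : Finset V) : Set V) := by
        rw [coe_insert]
        exact hCc.insert fun w hw _ => hu w hw
      have := hins.card_le_cliqueNum
      rw [card_insert_of_notMem huC] at this
      omega)
    (fun I hIs hIi => Nat.lt_succ_iff.1 (card_lt_of_not_isIndContained hG huv hnadj hIi
      fun w hw => (mem_filter.1 (hIs hw)).2))
  rw [← Nat.choose_symm_add]
  exact_mod_cast h.le

theorem nonadjCodegreeLE_log
    (hG : ¬ SimpleGraph.IsIndContained (completeBipartiteGraph (Fin 2) (Fin (r + 1))) G)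
    {s L : ℝ} (hs : s = G.cliqueNum) (hs0 : 0 < s) (hL : L = Real.log s) (hL0 : 20 ≤ L) :
    G.NonadjCodegreeLE ((20 * s / L) ^ r * (L / 20)) := by
  intro u v huv hnadj
  refine card_le_log_ramsey (F := Gᶜ) hs0 hL hL0 r _ (fun C hCs hCc => ?_) (fun I hIs hIi => ?_)
  · rw [SimpleGraph.isClique_compl] at hCc
    exact Nat.lt_succ_iff.1 (card_lt_of_not_isIndContained hG huv hnadj hCc
      fun w hw => (mem_filter.1 (hCs hw)).2)
  · rw [SimpleGraph.isIndepSet_compl] at hIi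
    rw [hs]
    exact_mod_cast hIi.card_le_cliqueNum

theorem succ_le_choose_add (b : ℕ) (hr : 1 ≤ r) : b + 1 ≤ (b + r).choose r := by
  rw [← Nat.choose_symm_add]
  calc b + 1 = (b + 1).choose b := by simp
    _ ≤ (b + r).choose b := Nat.choose_le_choose b (by omega)

theorem sq_mul_card_lt_choose (hr : 1 ≤ r)
    (hG : ¬ SimpleGraph.IsIndContained (completeBipartiteGraph (Fin 2) (Fin (r + 1))) G) {b : ℕ}
    (hb : G.cliqueNum = b + 1) {α : ℝ} (hα0 : 0 ≤ α) (hα1 : α ≤ 1)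
    (hα : (G.edgeSet.ncard : ℝ) = α * ((Fintype.card V).choose 2 : ℝ)) :
    α ^ 2 * (Fintype.card V : ℝ) < 4 * ((b + r).choose r : ℝ) := by
  have hK := succ_le_choose_add b hr
  refine sq_mul_card_lt (by exact_mod_cast (by omega : 1 ≤ (b + r).choose r)) (fun C hC => ?_)
    (nonadjCodegreeLE_choose hG hb) hα0 hα1 hα
  have := hC.card_le_cliqueNum
  exact_mod_cast (by omega : #C ≤ (b + r).choose r)

theorem exists_cliqueNum_eq_succ [Nonempty V] : ∃ b, G.cliqueNum = b + 1 := by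
  obtain ⟨v⟩ := ‹Nonempty V›
  have h : G.IsClique (({v} : Finset V) : Set V) := by simp
  have := h.card_le_cliqueNum
  rw [card_singleton] at this
  exact Nat.exists_eq_add_of_le' this

end CodegreeBounds

theorem succ_pow_succ_le (k : ℕ) :
    ((k : ℝ) + 1) ^ (k + 1) ≤ 4 ^ k * ((k + 1).factorial : ℝ) := by
  induction k with
  | zero => simp
  | succ k ih =>
    have hk : (0 : ℝ) < (k : ℝ) + 1 := by positivity
    have h1 : (((k : ℝ) + 2) / (k + 1)) ^ (k + 1) ≤ 4 := by
      have h2 : ((k : ℝ) + 2) / (k + 1) ≤ Real.exp (1 / (k + 1)) := by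
        refine le_trans (le_of_eq ?_) (Real.add_one_le_exp _)
        field_simp
        ring
      calc (((k : ℝ) + 2) / (k + 1)) ^ (k + 1) ≤ Real.exp (1 / (k + 1)) ^ (k + 1) := by gcongr
        _ = Real.exp 1 := by
          rw [← Real.exp_nat_mul]
          push_cast
          congr 1
          field_simp
        _ ≤ 4 := by linarith [Real.exp_one_lt_d9]
    rw [div_pow, div_le_iff₀ (by positivity)] at h1
    rw [Nat.factorial_succ (k + 1)]
    push_cast
    have h3 : ((k : ℝ) + 1 + 1) ^ (k + 1) ≤ 4 * (4 ^ k * ((k + 1).factorial : ℝ)) := by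
      rw [show (k : ℝ) + 1 + 1 = k + 2 by ring]
      linarith
    calc ((k : ℝ) + 1 + 1) ^ (k + 1 + 1) = ((k : ℝ) + 1 + 1) ^ (k + 1) * (k + 1 + 1) := pow_succ _ _
      _ ≤ 4 * (4 ^ k * ((k + 1).factorial : ℝ)) * (k + 1 + 1) := by gcongr
      _ = _ := by ring

theorem four_mul_choose_le (m : ℕ) {r : ℕ} (hr : 1 ≤ r) :
    4 * (m.choose r : ℝ) ≤ (4 * m / r) ^ r := by
  obtain ⟨k, rfl⟩ := Nat.exists_eq_add_of_le' hr
  have h1 : (m.choose (k + 1) : ℝ) ≤ (m : ℝ) ^ (k + 1) / ((k + 1).factorial : ℝ) :=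
    Nat.choose_le_pow_div (k + 1) m
  have h2 := succ_pow_succ_le k
  have hf : (0 : ℝ) < ((k + 1).factorial : ℝ) := by exact_mod_cast Nat.factorial_pos _
  push_cast
  rw [div_pow, le_div_iff₀ (by positivity)]
  calc 4 * (m.choose (k + 1) : ℝ) * ((k : ℝ) + 1) ^ (k + 1)
      ≤ 4 * ((m : ℝ) ^ (k + 1) / ((k + 1).factorial : ℝ)) *
        (4 ^ k * ((k + 1).factorial : ℝ)) := by gcongr
    _ = (4 * (m : ℝ)) ^ (k + 1) := by
      field_simp
      ring

theorem rpow_one_div_lt_of_lt_pow {x y : ℝ} {r : ℕ} (hr : 1 ≤ r) (hx : 0 ≤ x) (hy : 0 ≤ y)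
    (h : x < y ^ r) : x ^ (1 / (r : ℝ)) < y := by
  have h1 : x ^ (1 / (r : ℝ)) < (y ^ r) ^ (1 / (r : ℝ)) :=
    Real.rpow_lt_rpow hx h (by positivity)
  rwa [one_div, Real.pow_rpow_inv_natCast hy (by omega), ← one_div] at h1

theorem floor_sub_le_cliqueNum {V : Type*} [Fintype V] [Nonempty V] {G : SimpleGraph V} {r : ℕ}
    (hr : 1 ≤ r) {α : ℝ} (hα0 : 0 ≤ α) (hα1 : α ≤ 1)
    (hα : (G.edgeSet.ncard : ℝ) = α * ((Fintype.card V).choose 2 : ℝ))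
    (hG : ¬ SimpleGraph.IsIndContained (completeBipartiteGraph (Fin 2) (Fin (r + 1))) G) :
    ⌊(r : ℝ) / 4 * (α ^ 2 * (Fintype.card V : ℝ)) ^ (1 / (r : ℝ))⌋ - (r : ℤ) + 2 ≤
      (G.cliqueNum : ℤ) := by
  obtain ⟨b, hb⟩ := exists_cliqueNum_eq_succ (G := G)
  have hr0 : (0 : ℝ) < r := by exact_mod_cast hr
  have h1 := (sq_mul_card_lt_choose hr hG hb hα0 hα1 hα).trans_le (four_mul_choose_le (b + r) hr)
  have h2 := rpow_one_div_lt_of_lt_pow hr (by positivity) (by positivity) h1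
  rw [lt_div_iff₀ hr0] at h2
  have h3 : ⌊(r : ℝ) / 4 * (α ^ 2 * (Fintype.card V : ℝ)) ^ (1 / (r : ℝ))⌋ < (b : ℤ) + r := by
    rw [Int.floor_lt]
    push_cast at h2 ⊢
    linarith
  rw [hb]
  push_cast
  omega

theorem le_cliqueNum_of_log {V : Type*} [Fintype V] {G : SimpleGraph V} {r : ℕ}
    (hr : 1 ≤ r) {α₀ α : ℝ} (hα₀ : 0 < α₀) (hαα : α₀ ≤ α) (hα1 : α ≤ 1)
    (hα : (G.edgeSet.ncard : ℝ) = α * ((Fintype.card V).choose 2 : ℝ))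
    (hG : ¬ SimpleGraph.IsIndContained (completeBipartiteGraph (Fin 2) (Fin (r + 1))) G)
    (hω1 : Real.exp 20 ≤ G.cliqueNum) (hω2 : 4 * 20 ^ (r - 1) / α₀ ^ 2 ≤ G.cliqueNum) :
    (α ^ 2 * (Fintype.card V : ℝ) * Real.log (Fintype.card V) ^ (r - 1)) ^ (1 / (r : ℝ)) ≤
      20 * ((r : ℝ) + 1) * G.cliqueNum := by
  obtain ⟨k, rfl⟩ := Nat.exists_eq_add_of_le' hr
  rw [Nat.add_sub_cancel] at hω2 ⊢
  set s : ℝ := (G.cliqueNum : ℝ) with hs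
  set n : ℝ := (Fintype.card V : ℝ) with hn
  have hs0 : 0 < s := (Real.exp_pos 20).trans_le hω1
  set L : ℝ := Real.log s with hL
  have hL0 : 20 ≤ L := (Real.le_log_iff_exp_le hs0).2 hω1
  have hLpos : 0 < L := by linarith
  have hα0 : 0 < α := hα₀.trans_le hαα
  set K : ℝ := (20 * s / L) ^ (k + 1) * (L / 20) with hK
  have hKe : K * L ^ k = 20 ^ k * s ^ (k + 1) := by
    rw [hK, div_pow, mul_pow]
    field_simp
    ring
  have hsK : s ≤ K := by
    have h1 := one_le_pow₀ (one_le_ratio hs0 hL hL0) (n := k)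
    have h2 : K = (20 * s / L) ^ k * s := by
      rw [hK, pow_succ]
      field_simp
    rw [h2]
    nlinarith
  have hs1 : 1 ≤ s := by
    refine le_trans ?_ hω1
    exact Real.one_le_exp (by norm_num)
  have hcard : α ^ 2 * n < 4 * K :=
    sq_mul_card_lt (hs1.trans hsK)
      (fun C hC => le_trans (by rw [hs]; exact_mod_cast hC.card_le_cliqueNum) hsK)
      (nonadjCodegreeLE_log hG hs hs0 hL hL0) hα0.le hα1 hα
  have hn0 : 0 ≤ n := Nat.cast_nonneg _
  have hKle : K ≤ 20 ^ k * s ^ (k + 1) := by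
    rw [← hKe]
    exact le_mul_of_one_le_right (by positivity) (one_le_pow₀ (by linarith))
  have hns : n ≤ s ^ (k + 2) := by
    have h1 : α₀ ^ 2 * n ≤ α ^ 2 * n := by gcongr
    rw [div_le_iff₀ (by positivity)] at hω2
    have h2 : α₀ ^ 2 * n ≤ α₀ ^ 2 * s ^ (k + 2) := by
      calc α₀ ^ 2 * n ≤ (4 * 20 ^ k) * s ^ (k + 1) := by linarith
        _ ≤ (s * α₀ ^ 2) * s ^ (k + 1) := by gcongr
        _ = _ := by ring
    exact le_of_mul_le_mul_left h2 (by positivity)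
  have hlogn0 : 0 ≤ Real.log n := Real.log_natCast_nonneg _
  have hlog : Real.log n ≤ (k + 2) * L := by
    rcases hn0.eq_or_lt with h0 | h0
    · rw [← h0, Real.log_zero]
      positivity
    · have := Real.log_le_log h0 hns
      rw [Real.log_pow] at this
      push_cast at this
      exact this
  have hbound : α ^ 2 * n * Real.log n ^ k < (20 * ((k : ℝ) + 2) * s) ^ (k + 1) := by
    calc α ^ 2 * n * Real.log n ^ k ≤ α ^ 2 * n * ((k + 2) * L) ^ k := by gcongr
      _ < 4 * K * ((k + 2) * L) ^ k := by gcongr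
      _ = 4 * (K * L ^ k) * ((k : ℝ) + 2) ^ k := by
        rw [mul_pow]
        ring
      _ = 4 * (20 ^ k * s ^ (k + 1)) * ((k : ℝ) + 2) ^ k := by rw [hKe]
      _ ≤ (20 * ((k : ℝ) + 2)) * (20 ^ k * s ^ (k + 1)) * ((k : ℝ) + 2) ^ k := by
        gcongr
        linarith [(Nat.cast_nonneg k : (0 : ℝ) ≤ k)]
      _ = _ := by
        rw [mul_pow, mul_pow]
        ring
  have := rpow_one_div_lt_of_lt_pow (r := k + 1) (by omega) (by positivity) (by positivity) hbound
  refine this.le.trans (le_of_eq ?_)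
  push_cast
  ring

theorem exists_card_forall_le_cliqueNum {r : ℕ} (hr : 1 ≤ r) {α₀ : ℝ} (hα₀ : 0 < α₀) (W : ℕ) :
    ∃ N : ℕ, ∀ (V : Type*) [Fintype V] (G : SimpleGraph V) (α : ℝ),
      N ≤ Fintype.card V → α₀ ≤ α → α ≤ 1 →
      (G.edgeSet.ncard : ℝ) = α * ((Fintype.card V).choose 2 : ℝ) →
      ¬ SimpleGraph.IsIndContained (completeBipartiteGraph (Fin 2) (Fin (r + 1))) G →
      W ≤ G.cliqueNum := by
  refine ⟨⌈4 * ((W + r).choose r : ℝ) / α₀ ^ 2⌉₊ + 1, fun V _ G α hN hαα hα1 hα hG => ?_⟩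
  have hne : Nonempty V := Fintype.card_pos_iff.1 (by omega)
  obtain ⟨b, hb⟩ := exists_cliqueNum_eq_succ (G := G)
  by_contra! hW
  have h1 := sq_mul_card_lt_choose hr hG hb (hα₀.le.trans hαα) hα1 hα
  have h2 : ((b + r).choose r : ℝ) ≤ ((W + r).choose r : ℝ) := by
    exact_mod_cast Nat.choose_le_choose r (by omega)
  have h3 : 4 * ((W + r).choose r : ℝ) / α₀ ^ 2 ≤ (Fintype.card V : ℝ) :=
    (Nat.le_ceil _).trans (Nat.cast_le.2 (by omega))
  rw [div_le_iff₀ (by positivity)] at h3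
  have h4 : α₀ ^ 2 * (Fintype.card V : ℝ) ≤ α ^ 2 * (Fintype.card V : ℝ) := by gcongr
  linarith

theorem theorem1p7 (t : ℕ) (ht : 2 ≤ t) :
    (∀ (V : Type*) [Fintype V] [Nonempty V] (G : SimpleGraph V) (n : ℕ) (α : ℝ),
      Fintype.card V = n → 0 ≤ α → α ≤ 1 →
      (G.edgeSet.ncard : ℝ) = α * (n.choose 2 : ℝ) →
      ¬ SimpleGraph.IsIndContained (completeBipartiteGraph (Fin 2) (Fin t)) G →
      ⌊((t : ℝ) - 1) / 4 * (α ^ 2 * (n : ℝ)) ^ (1 / ((t : ℝ) - 1))⌋ - (t : ℤ) + 3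
        ≤ (G.cliqueNum : ℤ)) ∧
    (∀ α₀ : ℝ, 0 < α₀ → ∃ N : ℕ,
      ∀ (V : Type*) [Fintype V] (G : SimpleGraph V) (n : ℕ) (α : ℝ),
      Fintype.card V = n → N ≤ n → α₀ ≤ α → α ≤ 1 →
      (G.edgeSet.ncard : ℝ) = α * (n.choose 2 : ℝ) →
      ¬ SimpleGraph.IsIndContained (completeBipartiteGraph (Fin 2) (Fin t)) G →
      1 / (20 * (t : ℝ)) *
          (α ^ 2 * (n : ℝ) * Real.log (n : ℝ) ^ (t - 2)) ^ (1 / ((t : ℝ) - 1))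
        ≤ (G.cliqueNum : ℝ)) := by
  obtain ⟨r, rfl⟩ := Nat.exists_eq_add_of_le' (show 1 ≤ t by omega)
  have hr : 1 ≤ r := by omega
  have hcast : ((r + 1 : ℕ) : ℝ) - 1 = r := by push_cast; ring
  rw [hcast]
  refine ⟨?_, ?_⟩
  · rintro V _ _ G n α rfl hα0 hα1 hα hG
    have := floor_sub_le_cliqueNum hr hα0 hα1 hα hG
    push_cast
    linarith
  · intro α₀ hα₀
    obtain ⟨N, hN⟩ := exists_card_forall_le_cliqueNum hr hα₀
      (⌈Real.exp 20⌉₊ + ⌈4 * 20 ^ (r - 1) / α₀ ^ 2⌉₊)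
    refine ⟨N, ?_⟩
    rintro V _ G n α rfl hNn hαα hα1 hα hG
    have hW := hN V G α hNn hαα hα1 hα hG
    have h1 : Real.exp 20 ≤ G.cliqueNum :=
      (Nat.le_ceil _).trans (Nat.cast_le.2 (by omega))
    have h2 : 4 * 20 ^ (r - 1) / α₀ ^ 2 ≤ (G.cliqueNum : ℝ) :=
      (Nat.le_ceil _).trans (Nat.cast_le.2 (by omega))
    have h3 := le_cliqueNum_of_log hr hα₀ hαα hα1 hα hG h1 h2
    rw [show r + 1 - 2 = r - 1 by omega, one_div_mul_eq_div, div_le_iff₀ (by positivity)]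
    push_cast
    linarith
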